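/- There is an absolute constant $c>0$ such that for every $n$, every real $n\times n$ matrix $(a_{i,j})_{i,j=1}^n$ and all independent standard Gaussian random variables $g_{i,j}$, $i,j=1,\dots,n$, $$ \mathbb{E}\left\|(a_{i,j}g_{i,j})_{i,j=1}^n\right\|_{2\to 2} \le c\,\ln\!\left(e\,\frac{\|(a_{i,j})\|_1}{\|(a_{i,j})\|_\infty}\right) \left(\mathbb{E}\max_{1\le i\le n}\left\|(a_{i,j}g_{i,j})_{j=1}^n\right\|_2 +\mathbb{E}\max_{1\le j\le n}\left\|(a_{i,j}g_{i,j})_{i=1}^n\right\|_2\right), $$ where all three expectations are finite. Here $\|\cdot\|_{2\to 2}$ is the operator norm on $\ell_2^n$, $\|\cdot\|_2$ is the Euclidean norm on $\mathbb{R}^n$, $\|(a_{i,j})\|_1=\sum_{i,j=1}^n|a_{i,j}|$ and $\|(a_{i,j})\|_\infty=\max_{1\le i,j\le n}|a_{i,j}|$. (If all $a_{i,j}$ vanish, the right-hand side is read as $0$.) -/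

import Mathlib

open MeasureTheory ProbabilityTheory

universe u

noncomputable section

/-- The operator norm of a real square matrix acting on Euclidean space. -/
def opNorm22 {n : ℕ} (A : Matrix (Fin n) (Fin n) ℝ) : ℝ :=
  ‖Matrix.toEuclideanCLM (n := Fin n) (𝕜 := ℝ) A‖

/-- The entrywise `ℓ₁` norm: the sum of the absolute values of all entries. -/
def entryNorm1 {n : ℕ} (A : Matrix (Fin n) (Fin n) ℝ) : ℝ :=
  ∑ i, ∑ j, |A i j|

/-- The entrywise `ℓ_∞` norm: the largest absolute value of an entry. -/
def entryNormInf {n : ℕ} (A : Matrix (Fin n) (Fin n) ℝ) : ℝ :=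
  ⨆ p : Fin n × Fin n, |A p.1 p.2|

/-- The largest Euclidean norm of a row. -/
def maxRowNorm {n : ℕ} (A : Matrix (Fin n) (Fin n) ℝ) : ℝ :=
  ⨆ i, ‖(WithLp.toLp 2 (fun j => A i j) : EuclideanSpace ℝ (Fin n))‖

/-- The largest Euclidean norm of a column. -/
def maxColNorm {n : ℕ} (A : Matrix (Fin n) (Fin n) ℝ) : ℝ :=
  ⨆ j, ‖(WithLp.toLp 2 (fun i => A i j) : EuclideanSpace ℝ (Fin n))‖

/-- The random matrix `(a i j * g i j)` at the sample point `ω`. -/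
def weightedMatrix {n : ℕ} {Ω : Type u} (a : Matrix (Fin n) (Fin n) ℝ)
    (g : Fin n → Fin n → Ω → ℝ) (ω : Ω) : Matrix (Fin n) (Fin n) ℝ :=
  Matrix.of fun i j => a i j * g i j ω

end

open scoped Matrix

/-! The proof is the moment method behind the noncommutative Khintchine inequality, with a Frobenius
norm in the role of the dimension. The Gaussian law is invariant under sign changes, so for a fixed
sample B of the matrix it suffices to average the operator norm of (ε_ij b_ij) over signs. Its
symmetric dilation is S = ∑ ε_k A_k with ∑ A_k² diagonal, the entries being squared row and column
norms, at most τ². Flipping one sign at a time (`sum_sign_mul_trace_le`) gives E tr S^(2p+2) ≤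
(4(p+1)τ²)^p E tr S² (`sum_trace_signSum_pow_le`). The recursion stops at tr S² = 2‖B‖_F² rather
than at tr 1 = 2n, so when ‖B‖_F² ≤ lτ², a p of order ln(el) bounds the average norm by O(ln(el) τ),
free of n.

Take l = ‖a‖₁/‖a‖_∞ and τ = max row norm + max column norm + ‖B‖_F/√l. The last term is harmless:
E‖B‖_F ≤ (∑ a²)^(1/2) ≤ (‖a‖₁‖a‖_∞)^(1/2) = √l ‖a‖_∞, and ‖a‖_∞ E|g| is at most the expected max row
norm. -/

/-! ### Trace inequality for symmetric matrices -/

theorem pow_mul_pow_le_add_pow_of_even {q r : ℕ} (h : Even (q + r)) (x y : ℝ) :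
    x ^ q * y ^ r ≤ x ^ (q + r) + y ^ (q + r) := by
  have key : |x| ^ q * |y| ^ r ≤ |x| ^ (q + r) + |y| ^ (q + r) := by
    rcases le_total |x| |y| with hxy | hxy
    · calc |x| ^ q * |y| ^ r ≤ |y| ^ q * |y| ^ r := by gcongr
        _ = |y| ^ (q + r) := by rw [pow_add]
        _ ≤ _ := le_add_of_nonneg_left (by positivity)
    · calc |x| ^ q * |y| ^ r ≤ |x| ^ q * |x| ^ r := by gcongr
        _ = |x| ^ (q + r) := by rw [pow_add]
        _ ≤ _ := le_add_of_nonneg_right (by positivity)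
  rw [h.pow_abs, h.pow_abs] at key
  refine le_trans ?_ key
  rw [← abs_pow, ← abs_pow, ← abs_mul]
  exact le_abs_self _

theorem pow_sub_pow_eq_sum {R : Type*} [Ring R] (x y : R) (n : ℕ) :
    x ^ n - y ^ n = ∑ q ∈ Finset.range n, x ^ q * (x - y) * y ^ (n - 1 - q) := by
  induction n with
  | zero => simp
  | succ n ih =>
    rw [Finset.sum_range_succ']
    have h : ∀ q ∈ Finset.range n, x ^ (q + 1) * (x - y) * y ^ (n + 1 - 1 - (q + 1))
        = x * (x ^ q * (x - y) * y ^ (n - 1 - q)) := by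
      intro q _
      rw [pow_succ', show n + 1 - 1 - (q + 1) = n - 1 - q by omega]
      simp only [mul_assoc]
    rw [Finset.sum_congr rfl h, ← Finset.mul_sum, ← ih]
    simp only [pow_zero, one_mul, Nat.add_sub_cancel, Nat.sub_zero]
    rw [pow_succ', pow_succ']
    noncomm_ring

namespace Matrix

variable {ν : Type*} [Fintype ν] [DecidableEq ν]

theorem IsSymm.exists_pow_eq {X : Matrix ν ν ℝ} (hX : X.IsSymm) :
    ∃ (U : Matrix ν ν ℝ) (l : ν → ℝ), ∀ q : ℕ, X ^ q = U * diagonal (l ^ q) * Uᵀ := by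
  have hH : X.IsHermitian := by
    rw [IsHermitian, conjTranspose_eq_transpose_of_trivial]; exact hX
  refine ⟨hH.eigenvectorUnitary, hH.eigenvalues, fun q => ?_⟩
  have hs := hH.spectral_theorem
  conv_lhs => rw [hs, ← map_pow, diagonal_pow, Unitary.conjStarAlgAut_apply]
  rfl

/-- Diagonalise X and Y separately: the trace becomes ∑ c_ij² l_i^q m_j^r, with nonnegative weights
c_ij², and the scalar inequality applies termwise. Evenness of q + r handles negative eigenvalues.
-/
theorem trace_mul_pow_mul_mul_pow_le {A X Y : Matrix ν ν ℝ} (hA : A.IsSymm) (hX : X.IsSymm)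
    (hY : Y.IsSymm) {q r : ℕ} (h : Even (q + r)) :
    (A * X ^ q * A * Y ^ r).trace
      ≤ (A * A * X ^ (q + r)).trace + (A * A * Y ^ (q + r)).trace := by
  obtain ⟨U, l, hU⟩ := hX.exists_pow_eq
  obtain ⟨W, m, hW⟩ := hY.exists_pow_eq
  have formula : ∀ q r : ℕ, (A * X ^ q * A * Y ^ r).trace
      = ∑ i, ∑ j, ((Uᵀ * A * W) i j) ^ 2 * (l i ^ q * m j ^ r) := by
    intro q r
    have hC : Wᵀ * A * U = (Uᵀ * A * W)ᵀ := by
      rw [transpose_mul, transpose_mul, transpose_transpose, hA.eq, mul_assoc]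
    have e : (A * X ^ q * A * Y ^ r).trace
        = ((Uᵀ * A * W)ᵀ * (diagonal (l ^ q) * (Uᵀ * A * W) * diagonal (m ^ r))).trace := by
      rw [hU, hW, ← hC, ← mul_assoc, trace_mul_comm]
      simp only [mul_assoc]
    rw [e, trace, Finset.sum_comm]
    refine Finset.sum_congr rfl fun j _ => ?_
    rw [diag_apply, mul_apply]
    refine Finset.sum_congr rfl fun i _ => ?_
    rw [mul_diagonal, diagonal_mul, transpose_apply, Pi.pow_apply, Pi.pow_apply]
    ring
  -- Both traces on the right are instances of the same expansion, with one exponent equal to 0.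
  have e1 : (A * A * X ^ (q + r)).trace = (A * X ^ (q + r) * A * Y ^ 0).trace := by
    rw [pow_zero, mul_one, trace_mul_comm (A * X ^ (q + r)), ← mul_assoc]
  have e2 : (A * A * Y ^ (q + r)).trace = (A * X ^ 0 * A * Y ^ (q + r)).trace := by
    rw [pow_zero, mul_one]
  rw [e1, e2, formula, formula, formula, ← Finset.sum_add_distrib]
  refine Finset.sum_le_sum fun i _ => ?_
  rw [← Finset.sum_add_distrib]
  refine Finset.sum_le_sum fun j _ => ?_
  rw [← mul_add]
  refine mul_le_mul_of_nonneg_left ?_ (sq_nonneg _)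
  simpa using pow_mul_pow_le_add_pow_of_even h (l i) (m j)

end Matrix

/-! ### Khintchine recursion for random signs -/

/-- The sum of the matrices `A k` with signs `ε k`. -/
def signSum {ι ν : Type*} [Fintype ι] (A : ι → Matrix ν ν ℝ) (ε : ι → ℤˣ) : Matrix ν ν ℝ :=
  ∑ k, ((ε k : ℤ) : ℝ) • A k

theorem signSum_isSymm {ι ν : Type*} [Fintype ι] {A : ι → Matrix ν ν ℝ} (hA : ∀ k, (A k).IsSymm) (ε : ι → ℤˣ) :
    (signSum A ε).IsSymm := by
  rw [Matrix.IsSymm, signSum, Matrix.transpose_sum]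
  refine Finset.sum_congr rfl fun k _ => ?_
  rw [Matrix.transpose_smul, (hA k).eq]

/-- Reversal of the `k`-th sign. -/
def flipSign {ι : Type*} [DecidableEq ι] (k : ι) : (ι → ℤˣ) ≃ (ι → ℤˣ) where
  toFun ε := Function.update ε k (-ε k)
  invFun ε := Function.update ε k (-ε k)
  left_inv ε := by simp
  right_inv ε := by simp

theorem flipSign_apply_self {ι : Type*} [DecidableEq ι] (k : ι) (ε : ι → ℤˣ) : flipSign k ε k = -ε k := by
  change Function.update ε k (-ε k) k = -ε k
  simp

theorem flipSign_apply_of_ne {ι : Type*} [DecidableEq ι] {k i : ι} (h : i ≠ k) (ε : ι → ℤˣ) : flipSign k ε i = ε i := by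
  change Function.update ε k (-ε k) i = ε i
  simp [h]

section

variable {ι ν : Type*} [Fintype ι] [DecidableEq ι]

theorem signSum_sub_signSum_flipSign (A : ι → Matrix ν ν ℝ) (k : ι) (ε : ι → ℤˣ) :
    signSum A ε - signSum A (flipSign k ε) = (2 * ((ε k : ℤ) : ℝ)) • A k := by
  rw [signSum, signSum, ← Finset.sum_sub_distrib, Finset.sum_eq_single k]
  · rw [flipSign_apply_self, ← sub_smul]
    push_cast
    ring_nf
  · intro i _ hi
    rw [flipSign_apply_of_ne hi, sub_self]
  · simp

variable [Fintype ν] [DecidableEq ν]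

/-- A discrete integration by parts. Flipping ε_k is a bijection that negates the left side, so
twice that side is a sum of differences S^(2p+1) - S'^(2p+1). Since S - S' = 2ε_k A_k, telescoping
gives 2p + 1 traces of the form tr(A_k S^q A_k S'^(2p-q)). -/
theorem sum_sign_mul_trace_le {A : ι → Matrix ν ν ℝ} (hA : ∀ k, (A k).IsSymm) (k : ι) (p : ℕ) :
    ∑ ε : ι → ℤˣ, ((ε k : ℤ) : ℝ) * (A k * signSum A ε ^ (2 * p + 1)).trace
      ≤ 2 * (2 * p + 1) * ∑ ε : ι → ℤˣ, (A k * A k * signSum A ε ^ (2 * p)).trace := by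
  set S := signSum A
  have hS : ∀ ε, (S ε).IsSymm := signSum_isSymm hA
  have hflip : ∑ ε : ι → ℤˣ, ((ε k : ℤ) : ℝ) * (A k * S (flipSign k ε) ^ (2 * p + 1)).trace
      = -∑ ε : ι → ℤˣ, ((ε k : ℤ) : ℝ) * (A k * S ε ^ (2 * p + 1)).trace := by
    rw [← Finset.sum_neg_distrib, ← Equiv.sum_comp (flipSign k)
      (fun ε => -(((ε k : ℤ) : ℝ) * (A k * S ε ^ (2 * p + 1)).trace))]
    refine Finset.sum_congr rfl fun ε _ => ?_
    rw [flipSign_apply_self]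
    push_cast
    ring
  have hdiff : ∀ ε : ι → ℤˣ, ((ε k : ℤ) : ℝ) * (A k * S ε ^ (2 * p + 1)).trace
      - ((ε k : ℤ) : ℝ) * (A k * S (flipSign k ε) ^ (2 * p + 1)).trace
      = ∑ q ∈ Finset.range (2 * p + 1),
        2 * (A k * S ε ^ q * A k * S (flipSign k ε) ^ (2 * p - q)).trace := by
    intro ε
    have hsq : ((ε k : ℤ) : ℝ) * ((ε k : ℤ) : ℝ) = 1 := by
      rcases Int.units_eq_one_or (ε k) with h | h <;> simp [h]
    rw [← mul_sub, ← Matrix.trace_sub, ← mul_sub, pow_sub_pow_eq_sum,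
      signSum_sub_signSum_flipSign, Finset.mul_sum, Matrix.trace_sum, Finset.mul_sum]
    refine Finset.sum_congr rfl fun q _ => ?_
    rw [Nat.add_sub_cancel]
    simp only [Matrix.mul_smul, Matrix.smul_mul, Matrix.trace_smul, smul_eq_mul]
    rw [← mul_assoc (A k), ← mul_assoc (A k)]
    linear_combination 2 * (A k * S ε ^ q * A k * S (flipSign k ε) ^ (2 * p - q)).trace * hsq
  have hbound : ∀ ε : ι → ℤˣ, ∑ q ∈ Finset.range (2 * p + 1),
        2 * (A k * S ε ^ q * A k * S (flipSign k ε) ^ (2 * p - q)).trace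
      ≤ 2 * (2 * p + 1) * ((A k * A k * S ε ^ (2 * p)).trace
        + (A k * A k * S (flipSign k ε) ^ (2 * p)).trace) := by
    intro ε
    have : ∀ q ∈ Finset.range (2 * p + 1),
        2 * (A k * S ε ^ q * A k * S (flipSign k ε) ^ (2 * p - q)).trace
        ≤ 2 * ((A k * A k * S ε ^ (2 * p)).trace
        + (A k * A k * S (flipSign k ε) ^ (2 * p)).trace) := by
      intro q hq
      have hq' : q + (2 * p - q) = 2 * p := by
        have := Finset.mem_range.1 hq
        omega
      have := Matrix.trace_mul_pow_mul_mul_pow_le (hA k) (hS ε) (hS (flipSign k ε))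
        (q := q) (r := 2 * p - q) (by rw [hq']; exact even_two_mul p)
      rw [hq'] at this
      linarith
    refine (Finset.sum_le_sum this).trans (le_of_eq ?_)
    rw [Finset.sum_const, Finset.card_range, nsmul_eq_mul]
    push_cast
    ring
  have hsum := Finset.sum_le_sum fun ε (_ : ε ∈ Finset.univ) => (hdiff ε).le.trans (hbound ε)
  rw [Finset.sum_sub_distrib, hflip, ← Finset.mul_sum, Finset.sum_add_distrib,
    Equiv.sum_comp (flipSign k) (fun ε => (A k * A k * S ε ^ (2 * p)).trace)] at hsum
  linarith

theorem sum_trace_signSum_pow_succ_le {A : ι → Matrix ν ν ℝ} (hA : ∀ k, (A k).IsSymm) (p : ℕ) :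
    ∑ ε : ι → ℤˣ, (signSum A ε ^ (2 * (p + 1))).trace
      ≤ 2 * (2 * p + 1) * ∑ ε : ι → ℤˣ, ((∑ k, A k * A k) * signSum A ε ^ (2 * p)).trace := by
  have h : ∀ ε : ι → ℤˣ, (signSum A ε ^ (2 * (p + 1))).trace
      = ∑ k, ((ε k : ℤ) : ℝ) * (A k * signSum A ε ^ (2 * p + 1)).trace := by
    intro ε
    rw [show 2 * (p + 1) = (2 * p + 1) + 1 by ring, pow_succ']
    conv_lhs => rw [signSum]
    rw [Finset.sum_mul, Matrix.trace_sum]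
    refine Finset.sum_congr rfl fun k _ => ?_
    rw [Matrix.smul_mul, Matrix.trace_smul, smul_eq_mul]
    rfl
  simp only [h, Finset.sum_mul, Matrix.trace_sum]
  rw [Finset.sum_comm, Finset.sum_comm (f := fun ε k => (A k * A k * signSum A ε ^ (2 * p)).trace),
    Finset.mul_sum]
  exact Finset.sum_le_sum fun k _ => sum_sign_mul_trace_le hA k p

/-- The diagonal of S^(2p) is nonnegative, its entries being squared row norms of S^p. -/
theorem Matrix.trace_diagonal_mul_pow_le {v : ν → ℝ} {s : ℝ} (hv : ∀ i, v i ≤ s)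
    {S : Matrix ν ν ℝ} (hS : S.IsSymm) (p : ℕ) :
    (Matrix.diagonal v * S ^ (2 * p)).trace ≤ s * (S ^ (2 * p)).trace := by
  rw [Matrix.trace, Matrix.trace, Finset.mul_sum]
  refine Finset.sum_le_sum fun i _ => ?_
  rw [Matrix.diag_apply, Matrix.diag_apply, Matrix.diagonal_mul]
  refine mul_le_mul_of_nonneg_right (hv i) ?_
  rw [two_mul, pow_add, Matrix.mul_apply]
  refine Finset.sum_nonneg fun j _ => ?_
  rw [← (hS.pow p).apply i j]
  exact mul_self_nonneg _

theorem sum_trace_signSum_pow_le {A : ι → Matrix ν ν ℝ} (hA : ∀ k, (A k).IsSymm) {v : ν → ℝ}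
    (hV : ∑ k, A k * A k = Matrix.diagonal v) {s : ℝ} (hs : 0 ≤ s) (hv : ∀ i, v i ≤ s) (p : ℕ) :
    ∑ ε : ι → ℤˣ, (signSum A ε ^ (2 * (p + 1))).trace
      ≤ (4 * (p + 1) * s) ^ p * ∑ ε : ι → ℤˣ, (signSum A ε ^ 2).trace := by
  have hnn : 0 ≤ ∑ ε : ι → ℤˣ, (signSum A ε ^ 2).trace := by
    refine Finset.sum_nonneg fun ε _ => ?_
    have := Matrix.trace_diagonal_mul_pow_le (v := fun _ => 0) (s := 1) (fun _ => zero_le_one)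
      (signSum_isSymm hA ε) 1
    simpa using this
  induction p with
  | zero => simp
  | succ p ih =>
    have h1 := sum_trace_signSum_pow_succ_le hA (p + 1)
    rw [hV] at h1
    have h2 : ∑ ε : ι → ℤˣ, (Matrix.diagonal v * signSum A ε ^ (2 * (p + 1))).trace
        ≤ s * ∑ ε : ι → ℤˣ, (signSum A ε ^ (2 * (p + 1))).trace := by
      rw [Finset.mul_sum]
      exact Finset.sum_le_sum fun ε _ =>
        Matrix.trace_diagonal_mul_pow_le hv (signSum_isSymm hA ε) _
    calc _ ≤ _ := h1
      _ ≤ 2 * (2 * ((p + 1 : ℕ) : ℝ) + 1) * (s * ((4 * (p + 1) * s) ^ p *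
          ∑ ε : ι → ℤˣ, (signSum A ε ^ 2).trace)) := by
        gcongr
        exact h2.trans (mul_le_mul_of_nonneg_left ih hs)
      _ = (2 * (2 * ((p + 1 : ℕ) : ℝ) + 1) * s) * (4 * (p + 1) * s) ^ p *
          ∑ ε : ι → ℤˣ, (signSum A ε ^ 2).trace := by ring
      -- The new factor is 2(2p+3) ≤ 4(p+2); the earlier factors are enlarged to match it.
      _ ≤ (4 * (((p + 1 : ℕ) : ℝ) + 1) * s) * (4 * (((p + 1 : ℕ) : ℝ) + 1) * s) ^ p *
          ∑ ε : ι → ℤˣ, (signSum A ε ^ 2).trace := by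
        gcongr ?_ * s * (4 * ?_ * s) ^ p * _
        · linarith
        · push_cast; linarith
      _ = _ := by rw [← pow_succ']

end

/-! ### Symmetric dilation of a signed matrix -/

theorem trace_mul_transpose_eq_sum_sq {α : Type*} [Fintype α] (B : Matrix α α ℝ) :
    (B * Bᵀ).trace = ∑ i, ∑ j, B i j ^ 2 := by
  simp [Matrix.trace, Matrix.mul_apply, sq]

/-- The matrix `B` with signs `ε` attached to its entries. -/
def signedMatrix {α : Type*} (B : Matrix α α ℝ) (ε : α × α → ℤˣ) : Matrix α α ℝ :=
  Matrix.of fun i j => ((ε (i, j) : ℤ) : ℝ) * B i j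

theorem signedMatrix_sq_apply {α : Type*} (B : Matrix α α ℝ) (ε : α × α → ℤˣ) (i j : α) :
    signedMatrix B ε i j ^ 2 = B i j ^ 2 := by
  rcases Int.units_eq_one_or (ε (i, j)) with h | h <;> simp [signedMatrix, h]

section

variable {α : Type*} [DecidableEq α]

/-- The symmetric dilation of the matrix whose only nonzero entry is that of `B` at `k`. -/
def dilationSingle (B : Matrix α α ℝ) (k : α × α) : Matrix (α ⊕ α) (α ⊕ α) ℝ :=
  Matrix.fromBlocks 0 (Matrix.single k.1 k.2 (B k.1 k.2)) (Matrix.single k.2 k.1 (B k.1 k.2)) 0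

theorem dilationSingle_isSymm (B : Matrix α α ℝ) (k : α × α) : (dilationSingle B k).IsSymm := by
  simp [Matrix.IsSymm, dilationSingle, Matrix.fromBlocks_transpose]

variable [Fintype α]

theorem sum_dilationSingle_mul_self (B : Matrix α α ℝ) :
    ∑ k, dilationSingle B k * dilationSingle B k
      = Matrix.diagonal (Sum.elim (fun i => ∑ j, B i j ^ 2) (fun j => ∑ i, B i j ^ 2)) := by
  have h : ∀ k, dilationSingle B k * dilationSingle B k
      = Matrix.fromBlocks (Matrix.single k.1 k.1 (B k.1 k.2 ^ 2)) 0 0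
        (Matrix.single k.2 k.2 (B k.1 k.2 ^ 2)) := by
    intro k
    simp [dilationSingle, Matrix.fromBlocks_multiply, sq]
  simp only [h]
  ext (i | i) (j | j)
  · rw [Matrix.sum_apply, Fintype.sum_prod_type]
    by_cases hij : i = j
    · subst hij
      simp [Matrix.single_apply, Finset.sum_ite_irrel]
    · have : ∀ x, ¬(x = i ∧ x = j) := fun x hx => hij (hx.1.symm.trans hx.2)
      simp [hij, this]
  · simp [Matrix.sum_apply]
  · simp [Matrix.sum_apply]
  · rw [Matrix.sum_apply, Fintype.sum_prod_type]
    by_cases hij : i = j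
    · subst hij
      simp [Matrix.single_apply]
    · have : ∀ x, ¬(x = i ∧ x = j) := fun x hx => hij (hx.1.symm.trans hx.2)
      simp [hij, this]

theorem signSum_dilationSingle (B : Matrix α α ℝ) (ε : α × α → ℤˣ) :
    signSum (dilationSingle B) ε
      = Matrix.fromBlocks 0 (signedMatrix B ε) (signedMatrix B ε)ᵀ 0 := by
  ext (i | i) (j | j)
  · simp [signSum, Matrix.sum_apply, dilationSingle]
  · rw [signSum, Matrix.sum_apply, Finset.sum_eq_single (i, j)]
    · simp [dilationSingle, signedMatrix]
    · rintro ⟨a, b⟩ _ hk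
      have : ¬(a = i ∧ b = j) := fun h => hk (by rw [h.1, h.2])
      simp [dilationSingle, this]
    · simp
  · rw [signSum, Matrix.sum_apply, Finset.sum_eq_single (j, i)]
    · simp [dilationSingle, signedMatrix]
    · rintro ⟨a, b⟩ _ hk
      have : ¬(b = i ∧ a = j) := fun h => hk (by rw [h.1, h.2])
      simp [dilationSingle, this]
    · simp
  · simp [signSum, Matrix.sum_apply, dilationSingle]

theorem trace_dilation_pow (B : Matrix α α ℝ) (p : ℕ) :
    (Matrix.fromBlocks 0 B Bᵀ 0 ^ (2 * p)).trace = ((B * Bᵀ) ^ p).trace + ((Bᵀ * B) ^ p).trace := by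
  have h : Matrix.fromBlocks 0 B Bᵀ 0 ^ 2 = Matrix.fromBlocks (B * Bᵀ) 0 0 (Bᵀ * B) := by
    rw [sq, Matrix.fromBlocks_multiply]
    simp
  rw [pow_mul, h, Matrix.fromBlocks_diagonal_pow]
  simp [Matrix.trace]

theorem trace_dilation_sq (B : Matrix α α ℝ) :
    (Matrix.fromBlocks 0 B Bᵀ 0 ^ 2).trace = 2 * ∑ i, ∑ j, B i j ^ 2 := by
  have := trace_dilation_pow B 1
  rw [mul_one, pow_one, pow_one, Matrix.trace_mul_comm Bᵀ B, trace_mul_transpose_eq_sum_sq] at this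
  rw [this]
  ring

theorem sum_trace_dilation_signedMatrix_pow_le (B : Matrix α α ℝ) {s : ℝ} (hs : 0 ≤ s)
    (hrow : ∀ i, ∑ j, B i j ^ 2 ≤ s) (hcol : ∀ j, ∑ i, B i j ^ 2 ≤ s) (p : ℕ) :
    ∑ ε : α × α → ℤˣ,
      (Matrix.fromBlocks 0 (signedMatrix B ε) (signedMatrix B ε)ᵀ 0 ^ (2 * (p + 1))).trace
      ≤ Fintype.card (α × α → ℤˣ) * ((4 * (p + 1) * s) ^ p * (2 * ∑ i, ∑ j, B i j ^ 2)) := by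
  have h := sum_trace_signSum_pow_le (dilationSingle_isSymm B) (sum_dilationSingle_mul_self B) hs
    (by rintro (i | j) <;> simp [hrow, hcol]) p
  simp only [signSum_dilationSingle, trace_dilation_sq, signedMatrix_sq_apply] at h
  refine h.trans (le_of_eq ?_)
  rw [Finset.sum_const, Finset.card_univ, nsmul_eq_mul]
  ring

end

/-! ### From traces to the operator norm -/

theorem opNorm22_sq_le_sum_sq {n : ℕ} (A : Matrix (Fin n) (Fin n) ℝ) :
    opNorm22 A ^ 2 ≤ ∑ i, ∑ j, A i j ^ 2 := by
  have h0 : 0 ≤ ∑ i, ∑ j, A i j ^ 2 := by positivity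
  refine (Real.le_sqrt (norm_nonneg _) h0).1 ?_
  refine ContinuousLinearMap.opNorm_le_bound _ (Real.sqrt_nonneg _) fun x => ?_
  rw [EuclideanSpace.norm_eq x, ← Real.sqrt_mul h0, EuclideanSpace.norm_eq]
  refine Real.sqrt_le_sqrt ?_
  rw [Finset.sum_mul]
  refine Finset.sum_le_sum fun i _ => ?_
  simp only [Real.norm_eq_abs, sq_abs, Matrix.ofLp_toEuclideanCLM]
  change (∑ j, A i j * x j) ^ 2 ≤ _
  exact Finset.sum_mul_sq_le_sq_mul_sq _ _ _

open scoped Matrix.Norms.L2Operator in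
-- For self-adjoint M = BBᵀ, ‖M‖^(2^k) = ‖M^(2^k)‖, whose square is at most ‖M^(2^k)‖_F² = tr
-- M^(2^(k+1)). Restricting to powers of two costs only a constant factor in the end.
theorem opNorm22_pow_le_trace {n : ℕ} (B : Matrix (Fin n) (Fin n) ℝ) (k : ℕ) :
    opNorm22 B ^ (2 * 2 ^ (k + 1))
      ≤ (Matrix.fromBlocks 0 B Bᵀ 0 ^ (2 * 2 ^ (k + 1))).trace := by
  have hpow : ∀ M : Matrix (Fin n) (Fin n) ℝ, M.IsSymm →
      (M ^ 2 ^ (k + 1)).trace = ∑ i, ∑ j, (M ^ 2 ^ k) i j ^ 2 := by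
    intro M hM
    rw [← trace_mul_transpose_eq_sum_sq, (hM.pow _).eq, ← pow_add, ← two_mul, pow_succ']
  have hH : (B * Bᵀ).IsSymm := Matrix.isSymm_mul_transpose_self B
  have hH' : (Bᵀ * B).IsSymm := Matrix.isSymm_transpose_mul_self B
  have hsa : IsSelfAdjoint (B * Bᵀ) := hH
  have h1 : ‖B * Bᵀ‖ = ‖B‖ ^ 2 := by
    have := CStarRing.norm_self_mul_star (x := B)
    rw [sq]
    exact this
  have h2 : opNorm22 B ^ (2 * 2 ^ (k + 1)) = opNorm22 ((B * Bᵀ) ^ 2 ^ k) ^ 2 := by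
    change ‖B‖ ^ (2 * 2 ^ (k + 1)) = ‖(B * Bᵀ) ^ 2 ^ k‖ ^ 2
    rw [hsa.norm_pow_two_pow, h1, ← pow_mul, ← pow_mul]
    ring_nf
  rw [h2, trace_dilation_pow, hpow _ hH, hpow _ hH']
  refine (opNorm22_sq_le_sum_sq _).trans (le_add_of_nonneg_right (by positivity))

/-- Replaces Jensen's inequality in passing from an N-th moment to the mean, at the cost of a factor
2. -/
theorem le_add_mul_div_pow {z t : ℝ} (hz : 0 ≤ z) (ht : 0 < t) {N : ℕ} (hN : N ≠ 0) :
    z ≤ t + t * (z / t) ^ N := by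
  rcases le_total z t with h | h
  · exact h.trans (le_add_of_nonneg_right (by positivity))
  · have h1 : z / t ≤ (z / t) ^ N := le_self_pow₀ ((one_le_div ht).2 h) hN
    calc z = t * (z / t) := by field_simp
      _ ≤ t * (z / t) ^ N := by gcongr
      _ ≤ _ := le_add_of_nonneg_left ht.le

/-- A consequence of the noncommutative Khintchine inequality for matrices with independent
random signs. -/
theorem sum_opNorm22_signedMatrix_le {n : ℕ} (B : Matrix (Fin n) (Fin n) ℝ) (k : ℕ) {τ l : ℝ}
    (hτ : 0 ≤ τ) (hrow : ∀ i, ∑ j, B i j ^ 2 ≤ τ ^ 2) (hcol : ∀ j, ∑ i, B i j ^ 2 ≤ τ ^ 2)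
    (hB : ∑ i, ∑ j, B i j ^ 2 ≤ l * τ ^ 2) (hl : l ≤ 4 ^ 2 ^ (k + 1)) :
    ∑ ε : Fin n × Fin n → ℤˣ, opNorm22 (signedMatrix B ε)
      ≤ Fintype.card (Fin n × Fin n → ℤˣ) * (8 * 2 ^ (k + 1) * τ) := by
  rcases hτ.eq_or_lt with rfl | hτ
  · rw [mul_zero, mul_zero]
    refine Finset.sum_nonpos fun ε _ => ?_
    have h := opNorm22_sq_le_sum_sq (signedMatrix B ε)
    simp only [signedMatrix_sq_apply] at h
    have h2 : opNorm22 (signedMatrix B ε) ^ 2 ≤ 0 := h.trans (hB.trans (by simp))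
    exact (pow_eq_zero_iff two_ne_zero).1 (le_antisymm h2 (sq_nonneg _)) |>.le
  obtain ⟨p, hp⟩ : ∃ p, 2 ^ (k + 1) = p + 1 := Nat.exists_eq_succ_of_ne_zero (by positivity)
  have hpR : (2 : ℝ) ^ (k + 1) = p + 1 := by exact_mod_cast hp
  set c : ℝ := ((Fintype.card (Fin n × Fin n → ℤˣ) : ℕ) : ℝ)
  have hc0 : 0 ≤ c := Nat.cast_nonneg _
  -- Generous: order √(p+1) τ would suffice for the moment bound below, but linear growth matches
  -- the logarithm sought.
  set t : ℝ := 4 * (p + 1) * τ with ht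
  have ht0 : 0 < t := by positivity
  have hmoment : ∑ ε : Fin n × Fin n → ℤˣ, opNorm22 (signedMatrix B ε) ^ (2 * (p + 1))
      ≤ c * t ^ (2 * (p + 1)) := by
    have h1 : ∑ ε : Fin n × Fin n → ℤˣ, opNorm22 (signedMatrix B ε) ^ (2 * (p + 1))
        ≤ c * ((4 * (p + 1) * τ ^ 2) ^ p * (2 * ∑ i, ∑ j, B i j ^ 2)) := by
      refine le_trans (Finset.sum_le_sum fun ε _ => ?_)
        (sum_trace_dilation_signedMatrix_pow_le B (sq_nonneg τ) hrow hcol p)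
      have := opNorm22_pow_le_trace (signedMatrix B ε) k
      rwa [hp] at this
    refine h1.trans (mul_le_mul_of_nonneg_left ?_ hc0)
    have hp1 : (1 : ℝ) ≤ p + 1 := by linarith [(Nat.cast_nonneg p : (0 : ℝ) ≤ p)]
    have h2 : 2 * ∑ i, ∑ j, B i j ^ 2 ≤ 4 * (p + 1) * τ ^ 2 * 4 ^ (p + 1) := by
      rw [hp] at hl
      calc 2 * ∑ i, ∑ j, B i j ^ 2 ≤ 2 * (4 ^ (p + 1) * τ ^ 2) := by
            gcongr
            exact hB.trans (by gcongr)
        _ ≤ 4 * (p + 1) * (4 ^ (p + 1) * τ ^ 2) := by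
            gcongr
            linarith
        _ = _ := by ring
    calc (4 * (p + 1) * τ ^ 2) ^ p * (2 * ∑ i, ∑ j, B i j ^ 2)
        ≤ (4 * (p + 1) * τ ^ 2) ^ p * (4 * (p + 1) * τ ^ 2 * 4 ^ (p + 1)) := by gcongr
      _ = (4 * (p + 1) * τ ^ 2 * 4) ^ (p + 1) := by rw [mul_pow _ 4, ← mul_assoc, ← pow_succ]
      _ ≤ (t ^ 2) ^ (p + 1) := by
        gcongr
        rw [ht]
        nlinarith [sq_nonneg τ, mul_nonneg (sq_nonneg τ) (sub_nonneg.2 hp1),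
          mul_nonneg (mul_nonneg (sq_nonneg τ) (sub_nonneg.2 hp1)) (Nat.cast_nonneg p)]
      _ = _ := by rw [← pow_mul]
  calc ∑ ε : Fin n × Fin n → ℤˣ, opNorm22 (signedMatrix B ε)
      ≤ ∑ ε : Fin n × Fin n → ℤˣ,
        (t + t * (opNorm22 (signedMatrix B ε) / t) ^ (2 * (p + 1))) :=
        Finset.sum_le_sum fun ε _ => le_add_mul_div_pow (norm_nonneg _) ht0 (by omega)
    _ = c * t + t * ((∑ ε : Fin n × Fin n → ℤˣ,
        opNorm22 (signedMatrix B ε) ^ (2 * (p + 1))) / t ^ (2 * (p + 1))) := by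
        simp only [div_pow]
        rw [Finset.sum_add_distrib, Finset.sum_const, Finset.card_univ, nsmul_eq_mul,
          ← Finset.mul_sum, ← Finset.sum_div]
    _ ≤ c * t + t * c := by
        gcongr
        rw [div_le_iff₀ (by positivity)]
        exact hmoment
    _ = _ := by rw [hpR, ht]; ring

/-! ### Elementary norm comparisons -/

/-- The Frobenius norm. -/
noncomputable def frobNorm {n : ℕ} (A : Matrix (Fin n) (Fin n) ℝ) : ℝ :=
  √(∑ i, ∑ j, A i j ^ 2)

section

variable {n : ℕ} (A : Matrix (Fin n) (Fin n) ℝ)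

theorem frobNorm_nonneg : 0 ≤ frobNorm A := Real.sqrt_nonneg _

theorem frobNorm_sq : frobNorm A ^ 2 = ∑ i, ∑ j, A i j ^ 2 := Real.sq_sqrt (by positivity)

theorem opNorm22_le_frobNorm : opNorm22 A ≤ frobNorm A :=
  Real.le_sqrt_of_sq_le (opNorm22_sq_le_sum_sq A)

theorem norm_row_sq (i : Fin n) :
    ‖(WithLp.toLp 2 (fun j => A i j) : EuclideanSpace ℝ (Fin n))‖ ^ 2 = ∑ j, A i j ^ 2 := by
  simp [EuclideanSpace.norm_sq_eq]

theorem frobNorm_transpose : frobNorm Aᵀ = frobNorm A := by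
  rw [frobNorm, frobNorm, Finset.sum_comm]
  rfl

theorem maxRowNorm_nonneg : 0 ≤ maxRowNorm A := Real.iSup_nonneg fun _ => norm_nonneg _

theorem maxColNorm_nonneg : 0 ≤ maxColNorm A := Real.iSup_nonneg fun _ => norm_nonneg _

theorem sum_sq_row_le (i : Fin n) : ∑ j, A i j ^ 2 ≤ maxRowNorm A ^ 2 := by
  rw [← norm_row_sq]
  exact pow_le_pow_left₀ (norm_nonneg _) (le_ciSup
    (f := fun i => ‖(WithLp.toLp 2 (fun j => A i j) : EuclideanSpace ℝ (Fin n))‖)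
    (Set.finite_range _).bddAbove i) 2

theorem sum_sq_col_le (j : Fin n) : ∑ i, A i j ^ 2 ≤ maxColNorm A ^ 2 :=
  sum_sq_row_le Aᵀ j

theorem abs_le_maxRowNorm (i j : Fin n) : |A i j| ≤ maxRowNorm A := by
  refine abs_le_of_sq_le_sq ?_ (maxRowNorm_nonneg A)
  exact (Finset.single_le_sum (f := fun j => A i j ^ 2) (fun _ _ => sq_nonneg _)
    (Finset.mem_univ j)).trans (sum_sq_row_le A i)

theorem maxRowNorm_le_frobNorm : maxRowNorm A ≤ frobNorm A := by
  refine Real.iSup_le (fun i => Real.le_sqrt_of_sq_le ?_) (frobNorm_nonneg A)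
  rw [norm_row_sq]
  exact Finset.single_le_sum (f := fun i => ∑ j, A i j ^ 2)
    (fun _ _ => Finset.sum_nonneg fun _ _ => sq_nonneg _) (Finset.mem_univ i)

theorem maxColNorm_le_frobNorm : maxColNorm A ≤ frobNorm A := by
  rw [← frobNorm_transpose]
  exact maxRowNorm_le_frobNorm Aᵀ

theorem entryNormInf_nonneg : 0 ≤ entryNormInf A := Real.iSup_nonneg fun _ => abs_nonneg _

theorem abs_le_entryNormInf (i j : Fin n) : |A i j| ≤ entryNormInf A :=
  le_ciSup (f := fun p : Fin n × Fin n => |A p.1 p.2|) (Set.finite_range _).bddAbove (i, j)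

theorem sum_sq_le_entryNorm1_mul : ∑ i, ∑ j, A i j ^ 2 ≤ entryNorm1 A * entryNormInf A := by
  rw [entryNorm1, Finset.sum_mul]
  refine Finset.sum_le_sum fun i _ => ?_
  rw [Finset.sum_mul]
  refine Finset.sum_le_sum fun j _ => ?_
  rw [← sq_abs, sq]
  exact mul_le_mul_of_nonneg_left (abs_le_entryNormInf A i j) (abs_nonneg _)

theorem entryNormInf_le_entryNorm1 : entryNormInf A ≤ entryNorm1 A := by
  have h0 : 0 ≤ entryNorm1 A := by unfold entryNorm1; positivity
  refine Real.iSup_le (fun p => ?_) h0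
  calc |A p.1 p.2| ≤ ∑ j, |A p.1 j| := Finset.single_le_sum (f := fun j => |A p.1 j|)
        (fun _ _ => abs_nonneg _) (Finset.mem_univ p.2)
    _ ≤ entryNorm1 A := Finset.single_le_sum (f := fun i => ∑ j, |A i j|)
        (fun _ _ => Finset.sum_nonneg fun _ _ => abs_nonneg _) (Finset.mem_univ p.1)

theorem exists_abs_eq_entryNormInf (h : 0 < entryNormInf A) :
    ∃ i j, |A i j| = entryNormInf A := by
  have : Nonempty (Fin n × Fin n) := by
    by_contra hne
    rw [not_nonempty_iff] at hne
    rw [entryNormInf, Real.iSup_of_isEmpty] at h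
    exact lt_irrefl _ h
  obtain ⟨p, hp⟩ := exists_eq_ciSup_of_finite (f := fun p : Fin n × Fin n => |A p.1 p.2|)
  exact ⟨p.1, p.2, hp⟩

end

/-! ### Gaussian expectations -/

/-- The first absolute moment of the standard Gaussian distribution is positive. -/
theorem integral_abs_gaussianReal_pos : 0 < ∫ x, |x| ∂gaussianReal 0 1 := by
  have hint : Integrable (fun x : ℝ => |x|) (gaussianReal 0 1) :=
    ((memLp_id_gaussianReal 1).integrable (by norm_num)).abs
  rw [integral_pos_iff_support_of_nonneg (fun x => abs_nonneg x) hint]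
  have : Function.support (fun x : ℝ => |x|) = {0}ᶜ := by
    ext x
    simp
  have hna := nullSingletonClass_gaussianReal (μ := 0) (v := 1) one_ne_zero
  rw [this, prob_compl_eq_one_sub (measurableSet_singleton 0), measure_singleton]
  simp

/-- The law of a family of independent standard Gaussian variables. -/
noncomputable abbrev stdGaussianPi (ι : Type*) [Fintype ι] : Measure (ι → ℝ) :=
  Measure.pi fun _ => gaussianReal 0 1

section

variable {ι : Type*} [Fintype ι]

theorem measurePreserving_sign_mul (ε : ι → ℤˣ) :
    MeasurePreserving (fun (x : ι → ℝ) i => ((ε i : ℤ) : ℝ) * x i)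
      (stdGaussianPi ι) (stdGaussianPi ι) := by
  refine measurePreserving_pi _ _ (f := fun i y => ((ε i : ℤ) : ℝ) * y) fun i =>
    ⟨by fun_prop, ?_⟩
  rw [gaussianReal_map_const_mul]
  rcases Int.units_eq_one_or (ε i) with h | h
  · simp [h]
  · simp [h]

theorem integrable_sq_eval (i : ι) : Integrable (fun x : ι → ℝ => x i ^ 2) (stdGaussianPi ι) :=
  (measurePreserving_eval (fun _ : ι => gaussianReal 0 1) i).integrable_comp_of_integrable
    (g := fun y : ℝ => y ^ 2) (memLp_id_gaussianReal 2).integrable_sq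

theorem integral_comp_eval_stdGaussianPi (i : ι) {f : ℝ → ℝ} (hf : Continuous f) :
    ∫ x, f (x i) ∂stdGaussianPi ι = ∫ y, f y ∂gaussianReal 0 1 := by
  rw [← (measurePreserving_eval (fun _ : ι => gaussianReal 0 1) i).map_eq, integral_map]
  · exact (measurable_pi_apply i).aemeasurable
  · exact hf.aestronglyMeasurable

theorem integral_sq_eval (i : ι) : ∫ x, x i ^ 2 ∂stdGaussianPi ι = 1 := by
  rw [integral_comp_eval_stdGaussianPi i (f := fun y => y ^ 2) (by fun_prop)]
  have h := variance_id_gaussianReal (μ := 0) (v := 1)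
  rw [variance_eq_sub (memLp_id_gaussianReal 2)] at h
  simpa using h

end

/-- The matrix `(a i j * x (i, j))`. -/
def entrywiseMul {n : ℕ} (a : Matrix (Fin n) (Fin n) ℝ) (x : Fin n × Fin n → ℝ) :
    Matrix (Fin n) (Fin n) ℝ :=
  Matrix.of fun i j => a i j * x (i, j)

section

variable {n : ℕ} (a : Matrix (Fin n) (Fin n) ℝ)

theorem continuous_entrywiseMul : Continuous (entrywiseMul a) := by
  refine continuous_matrix fun i j => ?_
  simp only [entrywiseMul, Matrix.of_apply]
  fun_prop

theorem opNorm22_nonneg (A : Matrix (Fin n) (Fin n) ℝ) : 0 ≤ opNorm22 A := norm_nonneg _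

theorem continuous_opNorm22 : Continuous (opNorm22 (n := n)) := by
  have : Continuous (Matrix.toEuclideanCLM (n := Fin n) (𝕜 := ℝ)) :=
    LinearMap.continuous_of_finiteDimensional
      (Matrix.toEuclideanCLM (n := Fin n) (𝕜 := ℝ)).toAlgEquiv.toLinearMap
  exact continuous_norm.comp this

theorem continuous_frobNorm : Continuous (frobNorm (n := n)) := by
  unfold frobNorm
  fun_prop

theorem measurable_maxRowNorm_entrywiseMul :
    Measurable fun x => maxRowNorm (entrywiseMul a x) := by
  refine Measurable.iSup fun i => Continuous.measurable ?_
  simp only [entrywiseMul, Matrix.of_apply]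
  fun_prop

theorem measurable_maxColNorm_entrywiseMul :
    Measurable fun x => maxColNorm (entrywiseMul a x) := by
  refine Measurable.iSup fun i => Continuous.measurable ?_
  simp only [entrywiseMul, Matrix.of_apply]
  fun_prop

theorem integrable_frobNorm_sq :
    Integrable (fun x => frobNorm (entrywiseMul a x) ^ 2) (stdGaussianPi (Fin n × Fin n)) := by
  simp only [frobNorm_sq, entrywiseMul, Matrix.of_apply, mul_pow]
  exact integrable_finsetSum _ fun i _ => integrable_finsetSum _ fun j _ =>
    (integrable_sq_eval (i, j)).const_mul _

theorem integral_frobNorm_sq :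
    ∫ x, frobNorm (entrywiseMul a x) ^ 2 ∂stdGaussianPi (Fin n × Fin n)
      = ∑ i, ∑ j, a i j ^ 2 := by
  simp only [frobNorm_sq, entrywiseMul, Matrix.of_apply, mul_pow]
  rw [integral_finsetSum _ fun i _ => integrable_finsetSum _ fun j _ =>
    (integrable_sq_eval (i, j)).const_mul _]
  refine Finset.sum_congr rfl fun i _ => ?_
  rw [integral_finsetSum _ fun j _ => (integrable_sq_eval (i, j)).const_mul _]
  refine Finset.sum_congr rfl fun j _ => ?_
  rw [integral_const_mul, integral_sq_eval, mul_one]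

theorem integrable_frobNorm :
    Integrable (fun x => frobNorm (entrywiseMul a x)) (stdGaussianPi (Fin n × Fin n)) := by
  refine ((integrable_frobNorm_sq a).add (integrable_const (1 : ℝ))).mono'
    (continuous_frobNorm.comp (continuous_entrywiseMul a)).aestronglyMeasurable
    (Filter.Eventually.of_forall fun x => ?_)
  rw [Real.norm_of_nonneg (frobNorm_nonneg _), Pi.add_apply]
  nlinarith [sq_nonneg (frobNorm (entrywiseMul a x) - 1)]

theorem integral_frobNorm_le {D : ℝ} (hD : 0 < D) (h : ∑ i, ∑ j, a i j ^ 2 ≤ D ^ 2) :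
    ∫ x, frobNorm (entrywiseMul a x) ∂stdGaussianPi (Fin n × Fin n) ≤ D := by
  have h1 : ∫ x, frobNorm (entrywiseMul a x) ∂stdGaussianPi (Fin n × Fin n)
      ≤ ∫ x, (frobNorm (entrywiseMul a x) ^ 2 / (2 * D) + D / 2)
        ∂stdGaussianPi (Fin n × Fin n) := by
    refine integral_mono (integrable_frobNorm a)
      (((integrable_frobNorm_sq a).div_const _).add (integrable_const _)) fun x => ?_
    -- z ≤ z²/(2D) + D/2 takes the place of Cauchy–Schwarz.
    have : frobNorm (entrywiseMul a x) ^ 2 / (2 * D) + D / 2 - frobNorm (entrywiseMul a x)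
        = (frobNorm (entrywiseMul a x) - D) ^ 2 / (2 * D) := by
      field_simp
      ring
    have h2 : 0 ≤ (frobNorm (entrywiseMul a x) - D) ^ 2 / (2 * D) := by positivity
    linarith
  rw [integral_add ((integrable_frobNorm_sq a).div_const _) (integrable_const _),
    integral_div, integral_frobNorm_sq, integral_const] at h1
  simp only [probReal_univ, one_smul] at h1
  have h3 : (∑ i, ∑ j, a i j ^ 2) / (2 * D) ≤ D / 2 := by
    rw [div_le_iff₀ (by positivity)]
    linarith [h, sq D]
  linarith

theorem integrable_opNorm22 :
    Integrable (fun x => opNorm22 (entrywiseMul a x)) (stdGaussianPi (Fin n × Fin n)) := by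
  refine (integrable_frobNorm a).mono'
    (continuous_opNorm22.comp (continuous_entrywiseMul a)).aestronglyMeasurable
    (Filter.Eventually.of_forall fun x => ?_)
  rw [Real.norm_of_nonneg (opNorm22_nonneg _)]
  exact opNorm22_le_frobNorm _

theorem integrable_maxRowNorm :
    Integrable (fun x => maxRowNorm (entrywiseMul a x)) (stdGaussianPi (Fin n × Fin n)) := by
  refine (integrable_frobNorm a).mono' (measurable_maxRowNorm_entrywiseMul a).aestronglyMeasurable
    (Filter.Eventually.of_forall fun x => ?_)
  rw [Real.norm_of_nonneg (maxRowNorm_nonneg _)]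
  exact maxRowNorm_le_frobNorm _

theorem integrable_maxColNorm :
    Integrable (fun x => maxColNorm (entrywiseMul a x)) (stdGaussianPi (Fin n × Fin n)) := by
  refine (integrable_frobNorm a).mono' (measurable_maxColNorm_entrywiseMul a).aestronglyMeasurable
    (Filter.Eventually.of_forall fun x => ?_)
  rw [Real.norm_of_nonneg (maxColNorm_nonneg _)]
  exact maxColNorm_le_frobNorm _

theorem entryNormInf_mul_integral_abs_le (h : 0 < entryNormInf a) :
    entryNormInf a * ∫ y, |y| ∂gaussianReal 0 1
      ≤ ∫ x, maxRowNorm (entrywiseMul a x) ∂stdGaussianPi (Fin n × Fin n) := by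
  obtain ⟨i, j, hij⟩ := exists_abs_eq_entryNormInf a h
  rw [← integral_comp_eval_stdGaussianPi (i, j) continuous_abs, ← integral_const_mul]
  have hint : Integrable (fun x : Fin n × Fin n → ℝ => |x (i, j)|)
      (stdGaussianPi (Fin n × Fin n)) :=
    ((memLp_two_iff_integrable_sq (measurable_pi_apply (i, j)).aestronglyMeasurable).2 (integrable_sq_eval (i, j))).integrable
      one_le_two |>.abs
  refine integral_mono (hint.const_mul _) (integrable_maxRowNorm a) fun x => ?_
  simp only
  rw [← hij, ← abs_mul]
  exact abs_le_maxRowNorm (entrywiseMul a x) i j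

/-! ### Symmetrization and choice of the exponent -/

theorem integral_opNorm22_signedMatrix (ε : Fin n × Fin n → ℤˣ) :
    Integrable (fun x => opNorm22 (signedMatrix (entrywiseMul a x) ε))
        (stdGaussianPi (Fin n × Fin n)) ∧
      ∫ x, opNorm22 (signedMatrix (entrywiseMul a x) ε) ∂stdGaussianPi (Fin n × Fin n)
        = ∫ x, opNorm22 (entrywiseMul a x) ∂stdGaussianPi (Fin n × Fin n) := by
  have hmp := measurePreserving_sign_mul ε
  have hcont : Continuous fun x => opNorm22 (entrywiseMul a x) :=
    continuous_opNorm22.comp (continuous_entrywiseMul a)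
  have heq : (fun x => opNorm22 (signedMatrix (entrywiseMul a x) ε))
      = (fun x => opNorm22 (entrywiseMul a x)) ∘ fun x p => ((ε p : ℤ) : ℝ) * x p := by
    funext x
    rw [Function.comp_apply]
    congr 1
    ext i j
    simp only [signedMatrix, entrywiseMul, Matrix.of_apply]
    ring
  rw [heq]
  refine ⟨hmp.integrable_comp_of_integrable (integrable_opNorm22 a), ?_⟩
  conv_rhs => rw [← hmp.map_eq]
  rw [integral_map hmp.measurable.aemeasurable hcont.aestronglyMeasurable]
  rfl

theorem integral_opNorm22_le (k : ℕ) {l : ℝ} (hl : 0 < l) (hlk : l ≤ 4 ^ 2 ^ (k + 1)) :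
    ∫ x, opNorm22 (entrywiseMul a x) ∂stdGaussianPi (Fin n × Fin n)
      ≤ 8 * 2 ^ (k + 1) * (∫ x, maxRowNorm (entrywiseMul a x) ∂stdGaussianPi (Fin n × Fin n)
        + ∫ x, maxColNorm (entrywiseMul a x) ∂stdGaussianPi (Fin n × Fin n)
        + (∫ x, frobNorm (entrywiseMul a x) ∂stdGaussianPi (Fin n × Fin n)) / √l) := by
  set P := stdGaussianPi (Fin n × Fin n)
  set N : ℝ := ((Fintype.card (Fin n × Fin n → ℤˣ) : ℕ) : ℝ) with hN
  have hN0 : 0 < N := by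
    rw [hN]
    exact_mod_cast Fintype.card_pos
  -- The last summand forces ‖B‖_F² ≤ lτ² at every sample point, so l need not depend on the sample.
  let τ : (Fin n × Fin n → ℝ) → ℝ := fun x => maxRowNorm (entrywiseMul a x)
    + maxColNorm (entrywiseMul a x) + frobNorm (entrywiseMul a x) / √l
  have hpoint : ∀ x, ∑ ε : Fin n × Fin n → ℤˣ, opNorm22 (signedMatrix (entrywiseMul a x) ε)
      ≤ N * (8 * 2 ^ (k + 1) * τ x) := by
    intro x
    have hr := maxRowNorm_nonneg (entrywiseMul a x)
    have hc := maxColNorm_nonneg (entrywiseMul a x)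
    have hf : 0 ≤ frobNorm (entrywiseMul a x) / √l :=
      div_nonneg (frobNorm_nonneg _) (Real.sqrt_nonneg _)
    refine sum_opNorm22_signedMatrix_le _ k (by positivity) (fun i => ?_) (fun j => ?_) ?_ hlk
    · exact (sum_sq_row_le _ i).trans (pow_le_pow_left₀ hr (by linarith) 2)
    · exact (sum_sq_col_le _ j).trans (pow_le_pow_left₀ hc (by linarith) 2)
    · calc ∑ i, ∑ j, entrywiseMul a x i j ^ 2
          = l * (frobNorm (entrywiseMul a x) / √l) ^ 2 := by
            rw [div_pow, Real.sq_sqrt hl.le, frobNorm_sq]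
            field_simp
        _ ≤ l * τ x ^ 2 := by
            gcongr
            linarith
  have hr := integrable_maxRowNorm a
  have hc := integrable_maxColNorm a
  have hf := (integrable_frobNorm a).div_const √l
  have hτ : Integrable τ P := (hr.add hc).add hf
  have hτint : ∫ x, τ x ∂P = ∫ x, maxRowNorm (entrywiseMul a x) ∂P
      + ∫ x, maxColNorm (entrywiseMul a x) ∂P
      + (∫ x, frobNorm (entrywiseMul a x) ∂P) / √l := by
    rw [← integral_div, ← integral_add hr hc]
    exact integral_add (hr.add hc) hf
  have hint := integral_mono (μ := P)
    (integrable_finsetSum Finset.univ fun ε _ => (integral_opNorm22_signedMatrix a ε).1)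
    ((hτ.const_mul (8 * 2 ^ (k + 1))).const_mul N) hpoint
  rw [integral_finsetSum _ fun ε _ => (integral_opNorm22_signedMatrix a ε).1,
    Finset.sum_congr rfl fun ε _ => (integral_opNorm22_signedMatrix a ε).2, Finset.sum_const,
    Finset.card_univ, nsmul_eq_mul, integral_const_mul, integral_const_mul, hτint] at hint
  exact le_of_mul_le_mul_left hint hN0

theorem integral_opNorm22_le_log_mul :
    ∫ x, opNorm22 (entrywiseMul a x) ∂stdGaussianPi (Fin n × Fin n)
      ≤ 16 * (1 + (∫ y, |y| ∂gaussianReal 0 1)⁻¹)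
        * Real.log (Real.exp 1 * (entryNorm1 a / entryNormInf a))
        * (∫ x, maxRowNorm (entrywiseMul a x) ∂stdGaussianPi (Fin n × Fin n)
        + ∫ x, maxColNorm (entrywiseMul a x) ∂stdGaussianPi (Fin n × Fin n)) := by
  have hκ := integral_abs_gaussianReal_pos
  -- If a = 0 (in particular if n = 0), the ratio is 0/0 = 0 and `Real.log 0 = 0`, so both sides
  -- vanish.
  rcases (entryNormInf_nonneg a).eq_or_lt with h0 | hpos
  · have hz : ∀ x, opNorm22 (entrywiseMul a x) = 0 := by
      intro x
      have ha : ∀ i j, a i j = 0 := fun i j =>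
        abs_eq_zero.1 (le_antisymm (h0 ▸ abs_le_entryNormInf a i j) (abs_nonneg _))
      refine le_antisymm ((opNorm22_le_frobNorm _).trans (le_of_eq ?_)) (norm_nonneg _)
      simp [frobNorm, entrywiseMul, ha]
    simp [hz, ← h0]
  set m := entryNormInf a
  set κ := ∫ y, |y| ∂gaussianReal 0 1
  set l := entryNorm1 a / m with hl
  set R := ∫ x, maxRowNorm (entrywiseMul a x) ∂stdGaussianPi (Fin n × Fin n)
  set C := ∫ x, maxColNorm (entrywiseMul a x) ∂stdGaussianPi (Fin n × Fin n)
  have hC : 0 ≤ C := integral_nonneg fun x => maxColNorm_nonneg _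
  have hl1 : 1 ≤ l := (one_le_div hpos).2 (entryNormInf_le_entryNorm1 a)
  have hl0 : 0 < l := zero_lt_one.trans_le hl1
  have hlog : Real.log (Real.exp 1 * l) = 1 + Real.log l := by
    rw [Real.log_mul (Real.exp_ne_zero 1) hl0.ne', Real.log_exp]
  have hlog1 : 1 ≤ Real.log (Real.exp 1 * l) := by
    rw [hlog]
    linarith [Real.log_nonneg hl1]
  -- Choose 2^k ≤ ln(el) < 2^(k+1): the upper bound and e < 4 give l ≤ 4^(2^(k+1)), and the lower
  -- one turns 8 · 2^(k+1) into at most 16 ln(el).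
  obtain ⟨k, hk1, hk2⟩ := exists_nat_pow_near hlog1 one_lt_two
  have hlk : l ≤ 4 ^ 2 ^ (k + 1) := by
    calc l = Real.exp (Real.log l) := (Real.exp_log hl0).symm
      _ ≤ Real.exp (2 ^ (k + 1)) := Real.exp_le_exp.2 (by linarith)
      _ = Real.exp 1 ^ 2 ^ (k + 1) := by
        rw [← Real.exp_nat_mul]
        push_cast
        rw [mul_one]
      _ ≤ _ := by
        gcongr
        linarith [Real.exp_one_lt_d9]
  have hR : m ≤ κ⁻¹ * R := by
    rw [inv_mul_eq_div, le_div_iff₀ hκ]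
    exact entryNormInf_mul_integral_abs_le a hpos
  have hR0 : 0 ≤ R := integral_nonneg fun x => maxRowNorm_nonneg _
  have hsqrt : 0 < √l := Real.sqrt_pos.2 hl0
  have hF : (∫ x, frobNorm (entrywiseMul a x) ∂stdGaussianPi (Fin n × Fin n)) / √l ≤ m := by
    rw [div_le_iff₀ hsqrt]
    refine integral_frobNorm_le a (by positivity) ((sum_sq_le_entryNorm1_mul a).trans (le_of_eq ?_))
    change entryNorm1 a * m = _
    rw [mul_pow, Real.sq_sqrt hl0.le, hl]
    field_simp
  calc _ ≤ _ := integral_opNorm22_le a k hl0 hlk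
    _ ≤ 8 * 2 ^ (k + 1) * (R + C + κ⁻¹ * R) := by
      gcongr
      exact hF.trans hR
    _ = 16 * 2 ^ k * (R + C + κ⁻¹ * R) := by ring
    _ ≤ 16 * Real.log (Real.exp 1 * l) * ((1 + κ⁻¹) * (R + C)) := by
      gcongr
      have : 0 ≤ κ⁻¹ * C := by positivity
      linarith
    _ = _ := by ring

end

theorem theorem1p1 :
    ∃ c : ℝ, 0 < c ∧
      ∀ (n : ℕ) (a : Matrix (Fin n) (Fin n) ℝ)
        (Ω : Type u) [MeasurableSpace Ω] (μ : Measure Ω) [IsProbabilityMeasure μ]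
        (g : Fin n → Fin n → Ω → ℝ),
        (∀ i j, HasLaw (g i j) (gaussianReal 0 1) μ) →
        iIndepFun (fun (p : Fin n × Fin n) => g p.1 p.2) μ →
        Integrable (fun ω => opNorm22 (weightedMatrix a g ω)) μ ∧
        Integrable (fun ω => maxRowNorm (weightedMatrix a g ω)) μ ∧
        Integrable (fun ω => maxColNorm (weightedMatrix a g ω)) μ ∧
        ∫ ω, opNorm22 (weightedMatrix a g ω) ∂μ
          ≤ c * Real.log (Real.exp 1 * (entryNorm1 a / entryNormInf a)) *
            (∫ ω, maxRowNorm (weightedMatrix a g ω) ∂μ +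
              ∫ ω, maxColNorm (weightedMatrix a g ω) ∂μ) := by
  refine ⟨16 * (1 + (∫ y, |y| ∂gaussianReal 0 1)⁻¹), ?_, ?_⟩
  · have := integral_abs_gaussianReal_pos
    positivity
  intro n a Ω _ μ _ g hg hind
  have hlaw : HasLaw (fun ω (p : Fin n × Fin n) => g p.1 p.2 ω)
      (stdGaussianPi (Fin n × Fin n)) μ := hind.hasLaw_pi fun p => hg p.1 p.2
  -- By independence the g_ij have the product law jointly, so everything can be computed on the
  -- canonical space.
  have transfer : ∀ f : (Fin n × Fin n → ℝ) → ℝ, Integrable f (stdGaussianPi (Fin n × Fin n)) →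
      Integrable (fun ω => f fun p => g p.1 p.2 ω) μ ∧
      ∫ ω, f (fun p => g p.1 p.2 ω) ∂μ = ∫ x, f x ∂stdGaussianPi (Fin n × Fin n) := by
    intro f hf
    refine ⟨?_, hlaw.integral_comp hf.aestronglyMeasurable⟩
    rw [← hlaw.map_eq] at hf
    exact hf.comp_aemeasurable hlaw.aemeasurable
  obtain ⟨i1, e1⟩ := transfer _ (integrable_opNorm22 a)
  obtain ⟨i2, e2⟩ := transfer _ (integrable_maxRowNorm a)
  obtain ⟨i3, e3⟩ := transfer _ (integrable_maxColNorm a)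
  refine ⟨i1, i2, i3, ?_⟩
  have h := integral_opNorm22_le_log_mul a
  rw [← e1, ← e2, ← e3] at h
  exact h
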